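/- Let $n\ge 0$ and let $S_n$ act on rational functions in $\boldsymbol{x}=(x_1,\dots,x_n)$, $\boldsymbol{y}=(y_1,\dots,y_n)$ (coefficients in $\mathbb{C}$, or in the fraction field of any integral domain) by permuting the variables $\boldsymbol{x}$ and fixing $\boldsymbol{y}$. Let $s_i=(i,i+1)$, let $\ell(w)$ be the number of inversions of $w\in S_n$, let $w_0\in S_n$ be the longest element, and put $$\overline{\partial}_i f=\frac{x_{i+1}f-x_i\,s_i(f)}{x_{i+1}-x_i}\qquad(1\le i<n).$$ The double Grothendieck polynomials $\mathfrak{G}_w(\boldsymbol{x};\boldsymbol{y})$, $w\in S_n$, are (well) defined by $$\mathfrak{G}_{w_0}=\prod_{i+j\le n}\Bigl(1-\frac{x_i}{y_j}\Bigr),\qquad \mathfrak{G}_{ws_i}=\overline{\partial}_i\,\mathfrak{G}_w\quad\text{whenever }\ell(ws_i)<\ell(w).$$ Number the rows of an $n\times n$ grid from top to bottom and its columns from right to left. A pipe dream is a tiling of the grid by crossing tiles (one pipe runs from top to bottom, one from left to right) and elbow tiles (one pipe runs from top to right, one from left to bottom), such that every crossing tile lies strictly above the main diagonal (which joins the top left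 to the bottom right corner), i.e. in a row $i$ and column $j$ with $i+j\le n$. It is reduced if no two pipes cross more than once. It has permutation $w$ if for every $i$ the pipe that exits through the right boundary in row $i$ entered through the top boundary in column $w(i)$. The weight of a reduced pipe dream is the product of the weights of its tiles, where in row $i$ and column $j$ a crossing tile has weight $1-\frac{x_i}{y_j}$, and an elbow tile has weight $\frac{x_i}{y_j}$ if the two pipes through it cross at a tile north and/or west of it, and weight $1$ otherwise. Then for every $w\in S_n$, $\mathfrak{G}_w(\boldsymbol{x};\boldsymbol{y})$ is the sum of the weights of all reduced pipe dreams with permutation $w$. -/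

import Mathlib

namespace Grothendieck

/-! ### Rational functions in `x_1, …, x_n, y_1, …, y_n` -/

/-- The field of rational functions in `x_1, …, x_n; y_1, …, y_n` with coefficients in the
fraction field of `R`. Indices in `Fin n` are shifted by one: `x_{i+1}` is the variable
`Sum.inl i`, and `y_{j+1}` is the variable `Sum.inr j`. -/
abbrev RatFun (n : ℕ) (R : Type*) [CommRing R] : Type _ :=
  FractionRing (MvPolynomial (Fin n ⊕ Fin n) R)

/-- The variable `x_i`. -/
noncomputable def xVar (n : ℕ) (R : Type*) [CommRing R] (i : Fin n) : RatFun n R :=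
  algebraMap (MvPolynomial (Fin n ⊕ Fin n) R) (RatFun n R) (MvPolynomial.X (Sum.inl i))

/-- The variable `y_j`. -/
noncomputable def yVar (n : ℕ) (R : Type*) [CommRing R] (j : Fin n) : RatFun n R :=
  algebraMap (MvPolynomial (Fin n ⊕ Fin n) R) (RatFun n R) (MvPolynomial.X (Sum.inr j))

/-- The action of a permutation `u` on rational functions: it substitutes `x_{u i}` for `x_i`
and fixes the variables `y`. -/
noncomputable def permX (n : ℕ) (R : Type*) [CommRing R] (u : Equiv.Perm (Fin n)) :
    RatFun n R ≃+* RatFun n R :=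
  IsFractionRing.ringEquivOfRingEquiv
    (MvPolynomial.renameEquiv R (Equiv.sumCongr u (Equiv.refl (Fin n)))).toRingEquiv

/-- The simple transposition exchanging the (0-based) positions `i` and `i + 1`. -/
def simpleRefl (n i : ℕ) (hi : i + 1 < n) : Equiv.Perm (Fin n) :=
  Equiv.swap ⟨i, Nat.lt_of_succ_lt hi⟩ ⟨i + 1, hi⟩

/-- The isobaric divided difference operator
`f ↦ (x_{i+1} f - x_i s_i(f)) / (x_{i+1} - x_i)`. -/
noncomputable def divDiff (n : ℕ) (R : Type*) [CommRing R] [IsDomain R] (i : ℕ) (hi : i + 1 < n)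
    (f : RatFun n R) : RatFun n R :=
  (xVar n R ⟨i + 1, hi⟩ * f
      - xVar n R ⟨i, Nat.lt_of_succ_lt hi⟩ * permX n R (simpleRefl n i hi) f)
    / (xVar n R ⟨i + 1, hi⟩ - xVar n R ⟨i, Nat.lt_of_succ_lt hi⟩)

/-! ### Double Grothendieck polynomials -/

/-- The length of a permutation: its number of inversions. -/
def permLength {n : ℕ} (w : Equiv.Perm (Fin n)) : ℕ :=
  (Finset.univ.filter fun p : Fin n × Fin n => p.1 < p.2 ∧ w p.2 < w p.1).card

theorem permLength_le {n : ℕ} (w : Equiv.Perm (Fin n)) : permLength w ≤ n * n := by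
  refine (Finset.card_le_univ _).trans ?_
  simp

/-- The Grothendieck polynomial of the longest element: the product of `1 - x_i / y_j` over
`i + j ≤ n` (1-based indices). -/
noncomputable def grothendieckTop (n : ℕ) (R : Type*) [CommRing R] [IsDomain R] : RatFun n R :=
  ∏ p ∈ Finset.univ.filter (fun p : Fin n × Fin n => (p.1 : ℕ) + 1 + ((p.2 : ℕ) + 1) ≤ n),
    (1 - xVar n R p.1 / yVar n R p.2)

open Classical in
/-- The double Grothendieck polynomial of `w`. Starting from `w`, multiply on the right by
length-increasing simple transpositions until no more are available, that is, until the
longest element is reached, and apply the corresponding divided difference operators to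
`grothendieckTop`. That the result does not depend on the transpositions chosen on the way is
the property `IsGrothendieckFamily` below. -/
noncomputable def doubleGrothendieck (n : ℕ) (R : Type*) [CommRing R] [IsDomain R]
    (w : Equiv.Perm (Fin n)) : RatFun n R :=
  if h : ∃ i : ℕ, ∃ hi : i + 1 < n, permLength w < permLength (w * simpleRefl n i hi) then
    divDiff n R h.choose h.choose_spec.choose
      (doubleGrothendieck n R (w * simpleRefl n h.choose h.choose_spec.choose))
  else grothendieckTop n R
termination_by n * n - permLength w
decreasing_by
  have := h.choose_spec.choose_spec
  have := permLength_le (w * simpleRefl n h.choose h.choose_spec.choose)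
  omega

/-- The defining recursion of double Grothendieck polynomials:
`𝔊_{w₀} = ∏_{i + j ≤ n} (1 - x_i / y_j)`, and `𝔊_{w s_i}` is obtained from `𝔊_w` by the `i`-th
isobaric divided difference operator for *every* `w` and *every* `i` with `w s_i < w`. -/
def IsGrothendieckFamily (n : ℕ) (R : Type*) [CommRing R] [IsDomain R]
    (G : Equiv.Perm (Fin n) → RatFun n R) : Prop :=
  G Fin.revPerm = grothendieckTop n R ∧
    ∀ (w : Equiv.Perm (Fin n)) (i : ℕ) (hi : i + 1 < n),
      permLength (w * simpleRefl n i hi) < permLength w →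
        G (w * simpleRefl n i hi) = divDiff n R i hi (G w)

/-! ### Pipe dreams

A tiling of the `n × n` grid by crossing tiles and elbow tiles is encoded by the set `D` of
positions of its crossing tiles: `(i, j) ∈ D` if the tile in row `i`, counted from the top,
and column `j`, counted from the **right**, is a crossing; all other tiles are elbows. In a
crossing tile one pipe runs from top to bottom and one from left to right. In an elbow tile one
pipe runs from top to right and one from left to bottom. -/

/-- All crossings lie strictly above the main diagonal (from the top left to the bottom right
corner), that is, `i + j ≤ n` in 1-based indices. -/
def IsPipeDream {n : ℕ} (D : Finset (Fin n × Fin n)) : Prop :=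
  ∀ p ∈ D, (p.1 : ℕ) + 1 + ((p.2 : ℕ) + 1) ≤ n

/-- Pipes are named by the boundary edge at which they enter the grid. -/
inductive Pipe : Type
  /-- the pipe that enters through the top boundary, in column `c` counted from the left -/
  | fromTop (c : ℕ) : Pipe
  /-- the pipe that enters through the left boundary, in row `r` -/
  | fromLeft (r : ℕ) : Pipe
  deriving DecidableEq

/-- The tile in row `r` and in column `c` counted from the **left** is a crossing. -/
def CrossAt {n : ℕ} (D : Finset (Fin n × Fin n)) (r c : ℕ) : Prop :=
  ∃ p ∈ D, (p.1 : ℕ) = r ∧ (Fin.rev p.2 : ℕ) = c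

instance {n : ℕ} (D : Finset (Fin n × Fin n)) (r c : ℕ) : Decidable (CrossAt D r c) := by
  unfold CrossAt; infer_instance

/-- If `top c` are the pipes that enter row `r` from above, then `rowLeft D r top c` is the pipe
that enters the tile in row `r`, column `c` (from the left) through its left edge; this edge is
also the right edge of the tile in column `c - 1`. -/
def rowLeft {n : ℕ} (D : Finset (Fin n × Fin n)) (r : ℕ) (top : ℕ → Pipe) : ℕ → Pipe
  | 0 => Pipe.fromLeft r
  | c + 1 => if CrossAt D r c then rowLeft D r top c else top c

/-- The pipe that enters the tile in row `r`, column `c` (from the left) through its top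
edge. -/
def topPipe {n : ℕ} (D : Finset (Fin n × Fin n)) : ℕ → ℕ → Pipe
  | 0 => fun c => Pipe.fromTop c
  | r + 1 => fun c => if CrossAt D r c then topPipe D r c else rowLeft D r (topPipe D r) c

/-- The pipe that enters the tile in row `r`, column `c` (from the left) through its left edge.
For `c = n` this is the pipe on the right boundary edge of row `r`. -/
def leftPipe {n : ℕ} (D : Finset (Fin n × Fin n)) (r c : ℕ) : Pipe :=
  rowLeft D r (topPipe D r) c

/-- The unordered pair of pipes through the tile in row `i` and column `j` from the right. -/
def pipesAt {n : ℕ} (D : Finset (Fin n × Fin n)) (p : Fin n × Fin n) : Sym2 Pipe :=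
  s(topPipe D p.1 (Fin.rev p.2), leftPipe D p.1 (Fin.rev p.2))

/-- No two pipes cross more than once. -/
def IsReduced {n : ℕ} (D : Finset (Fin n × Fin n)) : Prop :=
  ∀ p ∈ D, ∀ q ∈ D, pipesAt D p = pipesAt D q → p = q

/-- The pipe dream `D` has permutation `w`: for every `i`, the pipe that exits through the right
boundary in row `i` (from the top) entered through the top boundary in column `w i` from the
right. -/
def HasPerm {n : ℕ} (D : Finset (Fin n × Fin n)) (w : Equiv.Perm (Fin n)) : Prop :=
  ∀ i : Fin n, leftPipe D i n = Pipe.fromTop (Fin.rev (w i))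

/-- The two pipes through the tile at `p` cross at a tile weakly north and weakly west of it
(columns are counted from the right, so west means larger column index). -/
def CrossedBefore {n : ℕ} (D : Finset (Fin n × Fin n)) (p : Fin n × Fin n) : Prop :=
  ∃ q ∈ D, q.1 ≤ p.1 ∧ p.2 ≤ q.2 ∧ pipesAt D q = pipesAt D p

instance {n : ℕ} (D : Finset (Fin n × Fin n)) (p : Fin n × Fin n) :
    Decidable (CrossedBefore D p) := by
  unfold CrossedBefore; infer_instance

/-- The weight of a pipe dream: the product over all tiles of `1 - x_i / y_j` for a crossing in
row `i` and column `j` from the right; of `x_i / y_j` for an elbow there whose two pipes have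
crossed before; and of `1` for every other elbow. -/
def pipeWeight {n : ℕ} {K : Type*} [Field K] (x y : Fin n → K) (D : Finset (Fin n × Fin n)) : K :=
  ∏ p : Fin n × Fin n,
    if p ∈ D then 1 - x p.1 / y p.2
    else if CrossedBefore D p then x p.1 / y p.2
    else 1

open Classical in
/-- The finite set of reduced pipe dreams with permutation `w`. -/
noncomputable def reducedPipeDreams {n : ℕ} (w : Equiv.Perm (Fin n)) :
    Finset (Finset (Fin n × Fin n)) :=
  Finset.univ.filter fun D => IsPipeDream D ∧ IsReduced D ∧ HasPerm D w

end Grothendieck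

/-! In the 0-Hecke algebra with π_k² = -π_k, the elements h_k(a) = 1 + (1 - a) π_k satisfy h_k(a)
h_k(b) = h_k(ab) and a Yang–Baxter equation. Multiply the factors h_{i+j-1}(x_i/y_j) over the tiles
with i + j ≤ n, in reading order. A crossing is a choice of π_k that increases the length; at a
descent the whole factor acts as the scalar a, which is the weight of an elbow whose pipes have
already crossed. Hence the coefficient of w is the pipe dream sum (`heckeFold_eq_sum`,
`pipeSum_eq_heckeFold`).

Exchanging x_i and x_{i+1} multiplies the product on the right by h_i(x_{i+1}/x_i): by Yang–Baxter
this factor travels through rows i and i+1 until it is absorbed at the diagonal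
(`heckeFold_comp_swap`). At a w with a descent at i, writing F_w for the coefficient, this reads
s_i(F_w) = (x_{i+1}/x_i) F_w + (1 - x_{i+1}/x_i) F_{w s_i}, which is the divided difference
recursion solved for s_i(F_w).

For w₀ every two pipes from the top must cross, which forces a crossing on every tile above the
diagonal (`eq_staircase`). So the pipe dream sums satisfy the defining recursion, and descending
induction on length identifies them with `doubleGrothendieck`. Consistency of the recursion is thus
a consequence of the formula; braid relations for divided differences are not needed. -/

namespace Grothendieck

/-! ### The Hecke operators and the Yang–Baxter equation -/

/-- The action of the factor `1 + (1 - a) π_k` of the `0`-Hecke algebra on coefficient functions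
of the right regular representation. -/
def heckeOp {K : Type*} [CommRing K] (k : ℕ) (a : K) (f : Equiv.Perm ℕ → K) :
    Equiv.Perm ℕ → K :=
  fun v => if v (k + 1) < v k then a * f v + (1 - a) * f (v * Equiv.swap k (k + 1)) else f v

section HeckeOp

variable {K : Type*} [CommRing K]

theorem heckeOp_one (k : ℕ) (f : Equiv.Perm ℕ → K) : heckeOp k 1 f = f := by
  funext v
  simp [heckeOp]

/-- At a descent v, the permutation v s_k is an ascent, where the inner operator is trivial; what
remains is a(1 - b) + (1 - a) = 1 - ab. -/
theorem heckeOp_heckeOp_self (k : ℕ) (a b : K) (f : Equiv.Perm ℕ → K) :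
    heckeOp k a (heckeOp k b f) = heckeOp k (a * b) f := by
  funext v
  rcases lt_or_gt_of_ne (v.injective.ne (Nat.succ_ne_self k)) with h | h
  · simp only [heckeOp, Equiv.Perm.mul_apply, Equiv.swap_apply_left, Equiv.swap_apply_right,
      if_pos h, if_neg h.not_gt]
    ring
  · simp only [heckeOp, if_neg h.not_gt]

theorem heckeOp_comm {k l : ℕ} (hkl : k + 2 ≤ l) (a b : K) (f : Equiv.Perm ℕ → K) :
    heckeOp k a (heckeOp l b f) = heckeOp l b (heckeOp k a f) := by
  have h1 : ∀ m, m = k ∨ m = k + 1 → Equiv.swap l (l + 1) m = m := fun m hm =>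
    Equiv.swap_apply_of_ne_of_ne (by omega) (by omega)
  have h2 : ∀ m, m = l ∨ m = l + 1 → Equiv.swap k (k + 1) m = m := fun m hm =>
    Equiv.swap_apply_of_ne_of_ne (by omega) (by omega)
  have h3 : Equiv.swap k (k + 1) * Equiv.swap l (l + 1)
      = Equiv.swap l (l + 1) * Equiv.swap k (k + 1) := by
    apply Equiv.Perm.Disjoint.commute
    intro m
    by_cases hm : m = k ∨ m = k + 1
    · exact Or.inr (h1 m hm)
    · exact Or.inl (Equiv.swap_apply_of_ne_of_ne (by omega) (by omega))
  funext v
  simp only [heckeOp, Equiv.Perm.mul_apply, h1 k (Or.inl rfl), h1 (k + 1) (Or.inr rfl),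
    h2 l (Or.inl rfl), h2 (l + 1) (Or.inr rfl), mul_assoc v, h3]
  split_ifs <;> ring

theorem swap_braid (k : ℕ) :
    Equiv.swap k (k + 1) * Equiv.swap (k + 1) (k + 2) * Equiv.swap k (k + 1)
      = Equiv.swap (k + 1) (k + 2) * Equiv.swap k (k + 1) * Equiv.swap (k + 1) (k + 2) := by
  ext m
  simp only [Equiv.Perm.mul_apply, Equiv.swap_apply_def]
  split_ifs <;> omega

theorem heckeOp_yangBaxter (k : ℕ) (a b : K) (f : Equiv.Perm ℕ → K) :
    heckeOp k a (heckeOp (k + 1) (a * b) (heckeOp k b f))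
      = heckeOp (k + 1) b (heckeOp k (a * b) (heckeOp (k + 1) a f)) := by
  have e1 : Equiv.swap k (k + 1) (k + 2) = k + 2 :=
    Equiv.swap_apply_of_ne_of_ne (by omega) (by omega)
  have e2 : Equiv.swap (k + 1) (k + 2) k = k :=
    Equiv.swap_apply_of_ne_of_ne (by omega) (by omega)
  funext v
  have hbr : v * Equiv.swap k (k + 1) * Equiv.swap (k + 1) (k + 2) * Equiv.swap k (k + 1)
      = v * Equiv.swap (k + 1) (k + 2) * Equiv.swap k (k + 1) * Equiv.swap (k + 1) (k + 2) := by
    simpa only [mul_assoc] using congrArg (v * ·) (swap_braid k)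
  have n1 : v k ≠ v (k + 1) := v.injective.ne (by omega)
  have n2 : v k ≠ v (k + 2) := v.injective.ne (by omega)
  have n3 : v (k + 1) ≠ v (k + 2) := v.injective.ne (by omega)
  have e3 : k + 1 + 1 = k + 2 := rfl
  simp only [heckeOp, Equiv.Perm.mul_apply, Equiv.swap_apply_left, Equiv.swap_apply_right, e1, e2,
    e3, hbr, Equiv.mul_swap_mul_self]
  -- Only the relative order of the values of v at k, k+1, k+2 matters: six cases, and two
  -- contradictory ones.
  rcases lt_or_gt_of_ne n1 with h1 | h1 <;> rcases lt_or_gt_of_ne n2 with h2 | h2 <;>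
    rcases lt_or_gt_of_ne n3 with h3 | h3 <;> first
    | omega
    | (simp only [h1, h2, h3, h1.not_gt, h2.not_gt, h3.not_gt, if_true, if_false] <;> ring)

theorem map_heckeOp {L : Type*} [CommRing L] (σ : K →+* L) (k : ℕ) (a : K)
    (f : Equiv.Perm ℕ → K) (v : Equiv.Perm ℕ) :
    σ (heckeOp k a f v) = heckeOp k (σ a) (fun u => σ (f u)) v := by
  unfold heckeOp
  split_ifs <;> simp

end HeckeOp

/-! ### Sequences of adjacent crossings -/

/-- The permutation obtained by performing, among the first `t` adjacent transpositions
`(pos s, pos s + 1)`, those with `s ∈ D`. -/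
def run (pos : ℕ → ℕ) (D : Finset ℕ) : ℕ → Equiv.Perm ℕ
  | 0 => 1
  | t + 1 => if t ∈ D then run pos D t * Equiv.swap (pos t) (pos t + 1) else run pos D t

/-- All crossings of `D` before time `t` increase the length. -/
def AscendsBefore (pos : ℕ → ℕ) (D : Finset ℕ) (t : ℕ) : Prop :=
  ∀ s < t, s ∈ D → run pos D s (pos s) < run pos D s (pos s + 1)

/-- The weight of the first `t` steps. -/
def runWeight {K : Type*} [CommRing K] (pos : ℕ → ℕ) (a : ℕ → K) (D : Finset ℕ) (t : ℕ) : K :=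
  ∏ s ∈ Finset.range t,
    if s ∈ D then 1 - a s
    else if run pos D s (pos s + 1) < run pos D s (pos s) then a s else 1

/-- The coefficient function of the product of the first `t` Hecke factors. -/
noncomputable def heckeFold {K : Type*} [CommRing K] (pos : ℕ → ℕ) (a : ℕ → K) : ℕ → Equiv.Perm ℕ → K
  | 0 => fun v => open Classical in if v = 1 then 1 else 0
  | t + 1 => heckeOp (pos t) (a t) (heckeFold pos a t)

section Run

variable {K : Type*} [CommRing K] {pos : ℕ → ℕ} {D : Finset ℕ}

theorem run_congr {E : Finset ℕ} {t : ℕ} (h : ∀ s < t, s ∈ D ↔ s ∈ E) :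
    run pos D t = run pos E t := by
  induction t with
  | zero => rfl
  | succ t ih =>
    simp only [run, ih fun s hs => h s (by omega), h t (by omega)]

theorem ascendsBefore_congr {E : Finset ℕ} {t : ℕ} (h : ∀ s < t, s ∈ D ↔ s ∈ E) :
    AscendsBefore pos D t ↔ AscendsBefore pos E t := by
  refine forall_congr' fun s => forall_congr' fun hs => ?_
  rw [h s hs, run_congr (t := s) fun u hu => h u (by omega)]

theorem runWeight_congr {E : Finset ℕ} {t : ℕ} (a : ℕ → K) (h : ∀ s < t, s ∈ D ↔ s ∈ E) :
    runWeight pos a D t = runWeight pos a E t := by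
  refine Finset.prod_congr rfl fun s hs => ?_
  have hs := Finset.mem_range.1 hs
  simp only [h s hs, run_congr (t := s) (pos := pos) fun u hu => h u (by omega)]

theorem ascendsBefore_succ {t : ℕ} : AscendsBefore pos D (t + 1) ↔
    AscendsBefore pos D t ∧ (t ∈ D → run pos D t (pos t) < run pos D t (pos t + 1)) := by
  constructor
  · exact fun h => ⟨fun s hs => h s (by omega), h t (by omega)⟩
  · rintro ⟨h1, h2⟩ s hs
    rcases Nat.lt_succ_iff_lt_or_eq.1 hs with h | rfl
    exacts [h1 s h, h2]

open Classical in
/-- The coefficients of a product of Hecke factors as sums over reduced subwords. -/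
theorem heckeFold_eq_sum (a : ℕ → K) (t : ℕ) (w : Equiv.Perm ℕ) :
    heckeFold pos a t w = ∑ D ∈ (Finset.range t).powerset,
      if AscendsBefore pos D t ∧ run pos D t = w then runWeight pos a D t else 0 := by
  induction t generalizing w with
  | zero => simp [heckeFold, AscendsBefore, run, runWeight, eq_comm]
  | succ t ih =>
    rw [Finset.range_add_one, Finset.sum_powerset_insert Finset.notMem_range_self, heckeFold,
      heckeOp, ih, ih]
    -- An elbow at step t leaves the permutation at w, so its weight is decided by whether w itself
    -- has a descent.
    have key1 : ∀ D ∈ (Finset.range t).powerset,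
        (if AscendsBefore pos D (t + 1) ∧ run pos D (t + 1) = w
          then runWeight pos a D (t + 1) else 0)
        = (if w (pos t + 1) < w (pos t) then a t else 1) *
          (if AscendsBefore pos D t ∧ run pos D t = w then runWeight pos a D t else 0) := by
      intro D hD
      have ht : t ∉ D := fun h => Finset.notMem_range_self (Finset.mem_powerset.1 hD h)
      simp only [ascendsBefore_succ, run, ht, if_false, false_imp_iff, and_true, runWeight,
        Finset.prod_range_succ]
      split_ifs <;> simp_all [mul_comm]
    -- A crossing at step t arrives from w s; it is an ascent there exactly when w has a descent,
    -- and is excluded otherwise.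
    have key2 : ∀ D ∈ (Finset.range t).powerset,
        (if AscendsBefore pos (insert t D) (t + 1) ∧ run pos (insert t D) (t + 1) = w
          then runWeight pos a (insert t D) (t + 1) else 0)
        = (if w (pos t + 1) < w (pos t) then 1 - a t else 0) *
          (if AscendsBefore pos D t ∧ run pos D t = w * Equiv.swap (pos t) (pos t + 1)
            then runWeight pos a D t else 0) := by
      intro D hD
      have hc : ∀ s < t, s ∈ insert t D ↔ s ∈ D := fun s hs => by simp [hs.ne]
      have hw : run pos D t * Equiv.swap (pos t) (pos t + 1) = w ↔
          run pos D t = w * Equiv.swap (pos t) (pos t + 1) := by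
        constructor <;> rintro h
        · simp [← h]
        · simp [h]
      simp only [ascendsBefore_succ, run, Finset.mem_insert_self, if_true, true_imp_iff, runWeight,
        Finset.prod_range_succ]
      rw [ascendsBefore_congr hc, run_congr hc, hw]
      change (if _ then runWeight pos a (insert t D) t * _ else _) = _
      rw [runWeight_congr a hc]
      by_cases h : run pos D t = w * Equiv.swap (pos t) (pos t + 1)
      · simp only [h, Equiv.Perm.mul_apply, Equiv.swap_apply_left, Equiv.swap_apply_right]
        split_ifs <;> simp_all [mul_comm, runWeight]
      · simp [h]
    rw [Finset.sum_congr rfl key1, Finset.sum_congr rfl key2, ← Finset.mul_sum, ← Finset.mul_sum]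
    split_ifs <;> ring

theorem inv_mul_swap_apply (v : Equiv.Perm ℕ) (k m : ℕ) :
    (v * Equiv.swap k (k + 1))⁻¹ m = Equiv.swap k (k + 1) (v⁻¹ m) := by
  simp [mul_inv_rev]

/-- As long as all crossings increase the length, a pair is inverted if and only if it has been
crossed. -/
theorem inverted_iff_crossed {t : ℕ} (h : AscendsBefore pos D t) {a b : ℕ} (hab : a < b) :
    (run pos D t)⁻¹ b < (run pos D t)⁻¹ a ↔
      ∃ s < t, s ∈ D ∧ run pos D s (pos s) = a ∧ run pos D s (pos s + 1) = b := by
  induction t with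
  | zero => simp [run, hab.le]
  | succ t ih =>
    obtain ⟨h, ht⟩ := ascendsBefore_succ.1 h
    have ih := ih h
    by_cases htD : t ∈ D
    · have ht := ht htD
      set v := run pos D t with hv
      set k := pos t with hk
      have hrun : run pos D (t + 1) = v * Equiv.swap k (k + 1) := by simp [run, htD, ← hv, ← hk]
      have hex : (∃ s < t + 1, s ∈ D ∧ run pos D s (pos s) = a ∧ run pos D s (pos s + 1) = b) ↔
          (∃ s < t, s ∈ D ∧ run pos D s (pos s) = a ∧ run pos D s (pos s + 1) = b) ∨
            (v k = a ∧ v (k + 1) = b) := by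
        constructor
        · rintro ⟨s, hs, h'⟩
          rcases Nat.lt_succ_iff_lt_or_eq.1 hs with h2 | rfl
          exacts [Or.inl ⟨s, h2, h'⟩, Or.inr h'.2]
        · rintro (⟨s, hs, h'⟩ | h')
          exacts [⟨s, by omega, h'⟩, ⟨t, by omega, htD, h'⟩]
      rw [hrun, hex, ← ih, inv_mul_swap_apply, inv_mul_swap_apply]
      have ha : ∀ m c, v m = c ↔ m = v⁻¹ c := fun m c => by
        rw [Equiv.Perm.eq_inv_iff_eq]
      rw [ha, ha]
      have hne : v⁻¹ a ≠ v⁻¹ b := v⁻¹.injective.ne hab.ne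
      -- The crossing is an ascent, so it cannot undo the inversion of a and b.
      have hno : ¬ (k = v⁻¹ b ∧ k + 1 = v⁻¹ a) := by
        rw [← ha, ← ha]
        omega
      simp only [Equiv.swap_apply_def]
      split_ifs <;> omega
    · have hrun : run pos D (t + 1) = run pos D t := by simp [run, htD]
      rw [hrun, ih]
      constructor
      · rintro ⟨s, hs, h'⟩
        exact ⟨s, by omega, h'⟩
      · rintro ⟨s, hs, h'⟩
        rcases Nat.lt_succ_iff_lt_or_eq.1 hs with h2 | rfl
        exacts [⟨s, h2, h'⟩, absurd h'.1 htD]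

end Run

/-! ### The tiles of the grid in reading order -/

/-- The position of the tile number `t` of the `n × n` grid in reading order. -/
def tilePos (n t : ℕ) : ℕ := t / n + (n - 1 - t % n)

/-- The weight attached to the tile number `t`; it is trivial outside of the staircase. -/
def tileWeight {K : Type*} [Field K] (n : ℕ) (x y : ℕ → K) (t : ℕ) : K :=
  if tilePos n t + 2 ≤ n then x (t / n) / y (n - 1 - t % n) else 1

/-- The product of the Hecke operators of the first `c` tiles of row `r`. -/
def rowOp {K : Type*} [CommRing K] (n r : ℕ) (a : ℕ → K) :
    ℕ → (Equiv.Perm ℕ → K) → Equiv.Perm ℕ → K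
  | 0, f => f
  | c + 1, f => heckeOp (r + (n - 1 - c)) (a c) (rowOp n r a c f)

/-- The weights of the tiles of row `r`, with row variable `p`. -/
def rowWeight {K : Type*} [Field K] (n : ℕ) (y : ℕ → K) (r : ℕ) (p : K) (c : ℕ) : K :=
  if r + (n - 1 - c) + 2 ≤ n then p / y (n - 1 - c) else 1

theorem mul_add_div_of_lt {n c : ℕ} (r : ℕ) (h : c < n) : (r * n + c) / n = r := by
  rw [mul_comm, Nat.mul_add_div (by omega), Nat.div_eq_of_lt h, add_zero]

theorem mul_add_mod_of_lt {n c : ℕ} (r : ℕ) (h : c < n) : (r * n + c) % n = c := by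
  rw [Nat.mul_add_mod', Nat.mod_eq_of_lt h]

/-! ### Exchange of adjacent row variables -/

section Rows

variable {K : Type*} [Field K] {n : ℕ}

theorem rowOp_eq_self {r c : ℕ} {a : ℕ → K} (h : ∀ d < c, a d = 1) (f : Equiv.Perm ℕ → K) :
    rowOp n r a c f = f := by
  induction c with
  | zero => rfl
  | succ c ih => rw [rowOp, h c (by omega), heckeOp_one, ih fun d hd => h d (by omega)]

theorem heckeOp_rowOp_comm {r c k : ℕ} (hk : ∀ d < c, k + 2 ≤ r + (n - 1 - d)) (a : ℕ → K)
    (b : K) (f : Equiv.Perm ℕ → K) :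
    heckeOp k b (rowOp n r a c f) = rowOp n r a c (heckeOp k b f) := by
  induction c with
  | zero => rfl
  | succ c ih =>
    rw [rowOp, rowOp, heckeOp_comm (hk c (by omega)), ih fun d hd => hk d (by omega)]

/-- Moving a Hecke factor through two consecutive rows exchanges the row variables. -/
theorem heckeOp_rowOp_rowOp {r c : ℕ} (hrc : r + 2 ≤ c) (hcn : c ≤ n) {p : K} (hp : p ≠ 0) (q : K)
    (y : ℕ → K) (f : Equiv.Perm ℕ → K) :
    heckeOp (r + (n - c)) (q / p)
        (rowOp n (r + 1) (rowWeight n y (r + 1) q) c (rowOp n r (rowWeight n y r p) c f))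
      = rowOp n (r + 1) (rowWeight n y (r + 1) p) c (rowOp n r (rowWeight n y r q) c f) := by
  have hqp : ∀ z : K, q / p * (p / z) = q / z := fun z => by
    rw [div_mul_div_comm, mul_comm q p, mul_div_mul_left _ _ hp]
  induction c, hrc using Nat.le_induction with
  -- Here row r+1 has no tile inside the staircase yet and row r has exactly one, in column r+1; its
  -- factor p/y absorbs q/p.
  | base =>
    have h1 : ∀ s : K, ∀ d < r + 2, rowWeight n y (r + 1) s d = 1 := fun s d hd =>
      if_neg (by omega)
    have h2 : ∀ s : K, ∀ d < r + 1, rowWeight n y r s d = 1 := fun s d hd => if_neg (by omega)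
    have h3 : ∀ s : K, rowWeight n y r s (r + 1) = s / y (n - 1 - (r + 1)) := fun s =>
      if_pos (by omega)
    have h4 : r + (n - (r + 2)) = r + (n - 1 - (r + 1)) := by omega
    rw [rowOp_eq_self (h1 q), rowOp_eq_self (h1 p), rowOp.eq_2 n r _ f (r + 1),
      rowOp.eq_2 n r _ f (r + 1), rowOp_eq_self (h2 q), rowOp_eq_self (h2 p), h3, h3, h4, heckeOp_heckeOp_self, hqp]
  | succ c hrc ih =>
    have ih := ih (by omega)
    have h1 : ∀ s : K, rowWeight n y (r + 1) s c = s / y (n - 1 - c) := fun s =>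
      if_pos (by omega)
    have h2 : ∀ s : K, rowWeight n y r s c = s / y (n - 1 - c) := fun s => if_pos (by omega)
    have h3 : r + (n - (c + 1)) = r + (n - 1 - c) := by omega
    have h4 : r + 1 + (n - 1 - c) = r + (n - 1 - c) + 1 := by omega
    have h5 : r + (n - c) = r + (n - 1 - c) + 1 := by omega
    have h6 : ∀ d < c, r + (n - 1 - c) + 2 ≤ r + 1 + (n - 1 - d) := fun d hd => by omega
    -- The row r factor of column c, at position k = r + (n-1-c), commutes with the earlier tiles of
    -- row r+1, whose positions are at least k+2. It then meets the row r+1 factor at k+1, and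
    -- Yang–Baxter applies with a = q/p and b = p/y.
    simp only [rowOp, h1, h2]
    rw [← heckeOp_rowOp_comm h6, ← heckeOp_rowOp_comm h6, h3, h4, ← hqp (y (n - 1 - c)), heckeOp_yangBaxter,
      ← h5, ih]

theorem heckeFold_row (x y : ℕ → K) (r : ℕ) {c : ℕ} (hc : c ≤ n) :
    heckeFold (tilePos n) (tileWeight n x y) (r * n + c)
      = rowOp n r (rowWeight n y r (x r)) c
          (heckeFold (tilePos n) (tileWeight n x y) (r * n)) := by
  induction c with
  | zero => rfl
  | succ c ih =>
    have hc' : c < n := hc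
    rw [← add_assoc, heckeFold, rowOp, ih hc'.le, tileWeight, tilePos, mul_add_div_of_lt r hc',
      mul_add_mod_of_lt r hc', rowWeight]

theorem heckeFold_succ_row (x y : ℕ → K) (r : ℕ) :
    heckeFold (tilePos n) (tileWeight n x y) ((r + 1) * n)
      = rowOp n r (rowWeight n y r (x r)) n
          (heckeFold (tilePos n) (tileWeight n x y) (r * n)) := by
  rw [← heckeFold_row x y r le_rfl, Nat.succ_mul]

/-- Exchanging two adjacent row variables amounts to multiplication by a Hecke factor. -/
theorem heckeFold_comp_swap (x y : ℕ → K) {i : ℕ} (hi : i + 1 < n) (hx : x i ≠ 0) :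
    heckeFold (tilePos n) (tileWeight n (x ∘ Equiv.swap i (i + 1)) y) (n * n)
      = heckeOp i (x (i + 1) / x i) (heckeFold (tilePos n) (tileWeight n x y) (n * n)) := by
  have hlow : ∀ r ≤ i, heckeFold (tilePos n) (tileWeight n (x ∘ Equiv.swap i (i + 1)) y) (r * n)
      = heckeFold (tilePos n) (tileWeight n x y) (r * n) := by
    intro r hr
    induction r with
    | zero => simp [heckeFold]
    | succ r ih =>
      rw [heckeFold_succ_row, heckeFold_succ_row, ih (by omega), Function.comp_apply,
        Equiv.swap_apply_of_ne_of_ne (by omega) (by omega)]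
  have hhigh : ∀ r, i + 2 ≤ r →
      heckeFold (tilePos n) (tileWeight n (x ∘ Equiv.swap i (i + 1)) y) (r * n)
      = heckeOp i (x (i + 1) / x i) (heckeFold (tilePos n) (tileWeight n x y) (r * n)) := by
    intro r hr
    induction r, hr using Nat.le_induction with
    | base =>
      rw [heckeFold_succ_row, heckeFold_succ_row, hlow i le_rfl, heckeFold_succ_row x,
        heckeFold_succ_row x]
      simp only [Function.comp_apply, Equiv.swap_apply_left, Equiv.swap_apply_right]
      rw [← heckeOp_rowOp_rowOp hi le_rfl hx, Nat.sub_self, add_zero]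
    -- Row r only uses positions at least r ≥ i+2, so it commutes with the new factor.
    | succ r hr ih =>
      rw [heckeFold_succ_row, heckeFold_succ_row, ih, Function.comp_apply,
        Equiv.swap_apply_of_ne_of_ne (by omega) (by omega),
        heckeOp_rowOp_comm fun d hd => by omega]
  exact hhigh n hi

end Rows

/-! ### Repeated crossings and descents -/

section Labels

variable {pos : ℕ → ℕ} {D : Finset ℕ}

/-- The unordered pair of labels that meet at step `t`. -/
def labelsAt (pos : ℕ → ℕ) (D : Finset ℕ) (t : ℕ) : Sym2 ℕ :=
  s(run pos D t (pos t), run pos D t (pos t + 1))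

/-- An earlier crossing has inverted the pair for good, so two labels that have crossed meet again
in decreasing order. -/
theorem exists_crossed_iff {t : ℕ} (h : AscendsBefore pos D t) :
    (∃ s < t, s ∈ D ∧ labelsAt pos D s = labelsAt pos D t) ↔
      run pos D t (pos t + 1) < run pos D t (pos t) := by
  constructor
  · rintro ⟨s, hst, hsD, hs⟩
    have hlt := h s hst hsD
    rcases Sym2.eq_iff.1 hs with ⟨h1, h2⟩ | ⟨h1, h2⟩
    · rw [h1, h2] at hlt
      have := (inverted_iff_crossed h hlt).2 ⟨s, hst, hsD, h1, h2⟩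
      simp at this
    · rwa [h1, h2] at hlt
  · intro hlt
    obtain ⟨s, hst, hsD, h1, h2⟩ := (inverted_iff_crossed h hlt).1 (by simp)
    exact ⟨s, hst, hsD, Sym2.eq_iff.2 (Or.inr ⟨h1, h2⟩)⟩

/-- The first crossing that fails to ascend would repeat an earlier pair, and a repeated pair would
cross at a descent. -/
theorem injOn_labelsAt_iff {N : ℕ} (hD : ∀ s ∈ D, s < N) :
    (∀ s ∈ D, ∀ t ∈ D, labelsAt pos D s = labelsAt pos D t → s = t) ↔ AscendsBefore pos D N := by
  constructor
  · intro h t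
    induction t using Nat.strong_induction_on with
    | _ t ih =>
      intro htN htD
      have hasc : AscendsBefore pos D t := fun s hst => ih s hst (hst.trans htN)
      refine lt_of_le_of_ne (not_lt.1 fun hlt => ?_)
        ((run pos D t).injective.ne (Nat.succ_ne_self _).symm)
      obtain ⟨s, hst, hsD, hs⟩ := (exists_crossed_iff hasc).2 hlt
      exact hst.ne (h s hsD t htD hs)
  · intro h
    have key : ∀ s ∈ D, ∀ t ∈ D, labelsAt pos D s = labelsAt pos D t → ¬ s < t := by
      intro s hs t ht hst hlt
      have hasc : AscendsBefore pos D t := fun u hu => h u (hu.trans (hD t ht))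
      exact (h t (hD t ht) ht).not_gt ((exists_crossed_iff hasc).1 ⟨s, hlt, hs, hst⟩)
    intro s hs t ht hst
    have h1 := key s hs t ht hst
    have h2 := key t ht s hs hst.symm
    omega

end Labels

/-! ### Pipes as labels -/

/-- The pipe with label `m`: labels less than `n` are the columns of the top boundary from the
right, the others continue along the left boundary from the top. -/
def pipeOf (n m : ℕ) : Pipe :=
  if m < n then Pipe.fromTop (n - 1 - m) else Pipe.fromLeft (m - n)

theorem pipeOf_injective (n : ℕ) : Function.Injective (pipeOf n) := by
  intro a b h
  unfold pipeOf at h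
  split_ifs at h <;> injection h <;> omega

/-- The number of a tile in reading order. -/
def tileIndex {n : ℕ} (p : Fin n × Fin n) : ℕ := (p.1 : ℕ) * n + (Fin.rev p.2 : ℕ)

/-- The numbers of the crossing tiles. -/
def tileSet {n : ℕ} (D : Finset (Fin n × Fin n)) : Finset ℕ := D.image tileIndex

section Tiles

variable {n : ℕ}

theorem tileIndex_div (p : Fin n × Fin n) : tileIndex p / n = p.1 :=
  mul_add_div_of_lt _ (Fin.rev p.2).isLt

theorem tileIndex_mod (p : Fin n × Fin n) : tileIndex p % n = Fin.rev p.2 :=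
  mul_add_mod_of_lt _ (Fin.rev p.2).isLt

theorem sub_tileIndex_mod (p : Fin n × Fin n) : n - 1 - tileIndex p % n = p.2 := by
  rw [tileIndex_mod, Fin.val_rev]
  omega

theorem tilePos_tileIndex (p : Fin n × Fin n) : tilePos n (tileIndex p) = p.1 + p.2 := by
  rw [tilePos, sub_tileIndex_mod, tileIndex_div]

theorem tileIndex_injective : Function.Injective (tileIndex (n := n)) := by
  intro p q h
  have h1 := congrArg (· / n) h
  have h2 := congrArg (n - 1 - · % n) h
  simp only [tileIndex_div, sub_tileIndex_mod] at h1 h2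
  exact Prod.ext (Fin.ext h1) (Fin.ext h2)

theorem image_tileIndex_univ :
    (Finset.univ : Finset (Fin n × Fin n)).image tileIndex = Finset.range (n * n) := by
  ext t
  simp only [Finset.mem_image, Finset.mem_univ, true_and, Finset.mem_range]
  constructor
  · rintro ⟨p, rfl⟩
    have h1 := p.1.isLt
    have h2 := (Fin.rev p.2).isLt
    unfold tileIndex
    nlinarith
  · intro ht
    have hn : 0 < n := Nat.pos_of_ne_zero (by rintro rfl; simp at ht)
    refine ⟨(⟨t / n, Nat.div_lt_of_lt_mul ht⟩, Fin.rev ⟨t % n, Nat.mod_lt t hn⟩), ?_⟩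
    simp only [tileIndex, Fin.rev_rev]
    exact Nat.div_add_mod' t n

theorem tileIndex_lt (p : Fin n × Fin n) : tileIndex p < n * n := by
  rw [← Finset.mem_range, ← image_tileIndex_univ]
  exact Finset.mem_image_of_mem _ (Finset.mem_univ p)

theorem tileIndex_mem {D : Finset (Fin n × Fin n)} {p : Fin n × Fin n} :
    tileIndex p ∈ tileSet D ↔ p ∈ D :=
  tileIndex_injective.mem_finset_image

theorem lt_of_mem_tileSet {D : Finset (Fin n × Fin n)} {t : ℕ} (ht : t ∈ tileSet D) :
    t < n * n := by
  obtain ⟨p, -, rfl⟩ := Finset.mem_image.1 ht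
  exact tileIndex_lt p

theorem mem_tileSet_iff_crossAt (D : Finset (Fin n × Fin n)) (r : ℕ) {c : ℕ} (hc : c < n) :
    r * n + c ∈ tileSet D ↔ CrossAt D r c := by
  simp only [tileSet, Finset.mem_image, CrossAt]
  refine exists_congr fun p => and_congr_right fun _ => ?_
  constructor
  · intro h
    have h1 := congrArg (· / n) h
    have h2 := congrArg (· % n) h
    simp only [tileIndex_div, tileIndex_mod, mul_add_div_of_lt r hc, mul_add_mod_of_lt r hc]
      at h1 h2
    exact ⟨h1, h2⟩
  · rintro ⟨rfl, rfl⟩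
    rfl

/-- The labels of the pipes along the boundary between the first `t` tiles and the others, from
the top right to the bottom left. -/
def frontier (D : Finset (Fin n × Fin n)) (t : ℕ) : Equiv.Perm ℕ := run (tilePos n) (tileSet D) t

theorem frontier_row_succ (D : Finset (Fin n × Fin n)) (r : ℕ) {c : ℕ} (hc : c < n) :
    frontier D (r * n + (c + 1)) =
      if CrossAt D r c then
        frontier D (r * n + c) * Equiv.swap (r + (n - 1 - c)) (r + (n - 1 - c) + 1)
      else frontier D (r * n + c) := by
  have hpos : tilePos n (r * n + c) = r + (n - 1 - c) := by
    rw [tilePos, mul_add_div_of_lt r hc, mul_add_mod_of_lt r hc]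
  rw [frontier, ← add_assoc, run, hpos]
  simp only [mem_tileSet_iff_crossAt D r hc, frontier]

theorem frontier_row_apply_of_ne (D : Finset (Fin n × Fin n)) (r m : ℕ) {c : ℕ} (hc : c ≤ n)
    (hm : ∀ d < c, m ≠ r + (n - 1 - d) ∧ m ≠ r + (n - 1 - d) + 1) :
    frontier D (r * n + c) m = frontier D (r * n) m := by
  induction c with
  | zero => rfl
  | succ c ih =>
    have ih := ih (by omega) fun d hd => hm d (by omega)
    rw [frontier_row_succ D r hc]
    split_ifs
    · rw [Equiv.Perm.mul_apply,
        Equiv.swap_apply_of_ne_of_ne (hm c (by omega)).1 (hm c (by omega)).2, ih]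
    · exact ih

theorem frontier_row_apply_of_le (D : Finset (Fin n × Fin n)) {r m : ℕ} (hm : n + r ≤ m) :
    frontier D (r * n) m = m := by
  induction r with
  | zero => simp [frontier, run]
  | succ r ih =>
    rw [Nat.succ_mul, frontier_row_apply_of_ne D r m le_rfl fun d hd => by omega, ih (by omega)]

/-- Positions below r are the right boundary edges of finished rows, which no later tile touches. -/
theorem frontier_row_apply_of_lt (D : Finset (Fin n × Fin n)) {r s m : ℕ} (hrs : r ≤ s)
    (hm : m < r) : frontier D (s * n) m = frontier D (r * n) m := by
  induction s, hrs using Nat.le_induction with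
  | base => rfl
  | succ s hs ih =>
    rw [Nat.succ_mul, frontier_row_apply_of_ne D s m le_rfl fun d hd => by omega, ih]

/-- Inside row r the frontier consists of top edges of the tiles still to come, the left edge of the
next tile, and bottom edges of the tiles passed, the latter shifted by one position. A tile turns
its top and left edges into its right and bottom edges, so the three claims need a joint induction.
-/
theorem row_pipes (D : Finset (Fin n × Fin n)) (r : ℕ)
    (htop : ∀ c < n, topPipe D r c = pipeOf n (frontier D (r * n) (r + (n - 1 - c)))) {c : ℕ}
    (hc : c ≤ n) :
    leftPipe D r c = pipeOf n (frontier D (r * n + c) (r + (n - c))) ∧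
    (∀ d < c, topPipe D (r + 1) d = pipeOf n (frontier D (r * n + c) (r + (n - 1 - d) + 1))) ∧
    ∀ d < n, c ≤ d → topPipe D r d = pipeOf n (frontier D (r * n + c) (r + (n - 1 - d))) := by
  induction c with
  | zero =>
    refine ⟨?_, by simp, fun d hd _ => htop d hd⟩
    rw [add_zero, frontier_row_apply_of_le D (by omega), pipeOf, if_neg (by omega)]
    simp only [leftPipe, rowLeft]
    congr 1
    omega
  | succ c ih =>
    obtain ⟨hl, hb, ht⟩ := ih (by omega)
    have htc := ht c hc le_rfl
    rw [frontier_row_succ D r hc]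
    have e1 : r + (n - (c + 1)) = r + (n - 1 - c) := by omega
    have e2 : r + (n - c) = r + (n - 1 - c) + 1 := by omega
    rw [e2] at hl
    unfold leftPipe at hl ⊢
    by_cases hx : CrossAt D r c
    · have hne : ∀ m, m ≠ r + (n - 1 - c) → m ≠ r + (n - 1 - c) + 1 →
          Equiv.swap (r + (n - 1 - c)) (r + (n - 1 - c) + 1) m = m := fun m =>
        Equiv.swap_apply_of_ne_of_ne
      simp only [hx, if_true, Equiv.Perm.mul_apply, rowLeft, e1, Equiv.swap_apply_left]
      refine ⟨hl, fun d hd => ?_, fun d hd hcd => ?_⟩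
      · rcases Nat.lt_succ_iff_lt_or_eq.1 hd with hd | rfl
        · rw [hne _ (by omega) (by omega), hb d hd]
        · simp only [topPipe, hx, if_true, Equiv.swap_apply_right, htc]
      · rw [hne _ (by omega) (by omega), ht d hd (by omega)]
    · simp only [hx, if_false, rowLeft, e1]
      refine ⟨htc, fun d hd => ?_, fun d hd hcd => ht d hd (by omega)⟩
      rcases Nat.lt_succ_iff_lt_or_eq.1 hd with hd | rfl
      · exact hb d hd
      · simp only [topPipe, hx, if_false, hl]

theorem topPipe_row (D : Finset (Fin n × Fin n)) (r : ℕ) {c : ℕ} (hc : c < n) :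
    topPipe D r c = pipeOf n (frontier D (r * n) (r + (n - 1 - c))) := by
  induction r generalizing c with
  | zero =>
    have h : frontier D (0 * n) = 1 := by simp [frontier, run]
    rw [h, Equiv.Perm.one_apply, pipeOf, if_pos (by omega), topPipe]
    congr 1
    omega
  | succ r ih =>
    rw [(row_pipes D r (fun c hc => ih hc) le_rfl).2.1 c hc, Nat.succ_mul]
    congr 2
    omega

theorem pipesAt_eq (D : Finset (Fin n × Fin n)) (p : Fin n × Fin n) :
    pipesAt D p = (labelsAt (tilePos n) (tileSet D) (tileIndex p)).map (pipeOf n) := by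
  have hc := (Fin.rev p.2).isLt
  obtain ⟨h1, -, h2⟩ := row_pipes D p.1 (fun c hc => topPipe_row D p.1 hc) hc.le
  have e1 : (p.1 : ℕ) + (n - 1 - (Fin.rev p.2 : ℕ)) = p.1 + p.2 := by
    rw [Fin.val_rev]; omega
  have e2 : (p.1 : ℕ) + (n - (Fin.rev p.2 : ℕ)) = p.1 + p.2 + 1 := by
    rw [Fin.val_rev]; omega
  rw [pipesAt, h1, h2 _ hc le_rfl, labelsAt, tilePos_tileIndex, e1, e2]
  rfl

theorem pipesAt_eq_iff (D : Finset (Fin n × Fin n)) (p q : Fin n × Fin n) :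
    pipesAt D p = pipesAt D q ↔
      labelsAt (tilePos n) (tileSet D) (tileIndex p)
        = labelsAt (tilePos n) (tileSet D) (tileIndex q) := by
  rw [pipesAt_eq, pipesAt_eq, (Sym2.map.injective (pipeOf_injective n)).eq_iff]

theorem isReduced_iff (D : Finset (Fin n × Fin n)) :
    IsReduced D ↔ AscendsBefore (tilePos n) (tileSet D) (n * n) := by
  rw [← injOn_labelsAt_iff fun s hs => lt_of_mem_tileSet hs]
  simp only [tileSet, Finset.forall_mem_image]
  refine forall₂_congr fun p _ => forall₂_congr fun q _ => ?_
  rw [pipesAt_eq_iff, tileIndex_injective.eq_iff, tileSet]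

theorem leftPipe_last (D : Finset (Fin n × Fin n)) (i : Fin n) :
    leftPipe D i n = pipeOf n (frontier D (n * n) i) := by
  rw [(row_pipes D i (fun c hc => topPipe_row D i hc) le_rfl).1, Nat.sub_self, add_zero,
    ← Nat.succ_mul, frontier_row_apply_of_lt D (Nat.succ_le_of_lt i.isLt) (Nat.lt_succ_self _)]

theorem hasPerm_iff (D : Finset (Fin n × Fin n)) (w : Equiv.Perm (Fin n)) :
    HasPerm D w ↔ ∀ i : Fin n, frontier D (n * n) i = w i := by
  refine forall_congr' fun i => ?_
  have h : Pipe.fromTop (Fin.rev (w i)) = pipeOf n (w i) := by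
    rw [pipeOf, if_pos (w i).isLt, Fin.val_rev]
    congr 1
    omega
  rw [leftPipe_last, h, (pipeOf_injective n).eq_iff]

/-- Crossings above the diagonal only exchange positions below n. -/
theorem IsPipeDream.frontier_apply_of_le {D : Finset (Fin n × Fin n)} (hD : IsPipeDream D)
    (t : ℕ) {m : ℕ} (hm : n ≤ m) : frontier D t m = m := by
  induction t with
  | zero => rfl
  | succ t ih =>
    unfold frontier at ih ⊢
    rw [run]
    split_ifs with ht
    · obtain ⟨p, hp, rfl⟩ := Finset.mem_image.1 ht
      have := hD p hp
      rw [tilePos_tileIndex, Equiv.Perm.mul_apply,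
        Equiv.swap_apply_of_ne_of_ne (by omega) (by omega), ih]
    · exact ih

/-- A pipe only moves down and to the right. -/
theorem mod_le_mod_of_label {s t : ℕ} (hst : s < t) (hn : 0 < n) (D : Finset ℕ) (P : ℕ)
    (hs : P ∈ labelsAt (tilePos n) D s) (ht : P ∈ labelsAt (tilePos n) D t) :
    s % n ≤ t % n := by
  have hmem : ∀ t, P ∈ labelsAt (tilePos n) D t →
      (run (tilePos n) D t)⁻¹ P = tilePos n t ∨ (run (tilePos n) D t)⁻¹ P = tilePos n t + 1 := by
    intro t h
    rw [Equiv.Perm.inv_eq_iff_eq, Equiv.Perm.inv_eq_iff_eq]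
    exact Sym2.mem_iff.1 h
  have hstep : ∀ t, (run (tilePos n) D (t + 1))⁻¹ P = (run (tilePos n) D t)⁻¹ P ∨
      (run (tilePos n) D (t + 1))⁻¹ P
        = Equiv.swap (tilePos n t) (tilePos n t + 1) ((run (tilePos n) D t)⁻¹ P) := by
    intro t
    rw [run]
    split_ifs
    · exact Or.inr (inv_mul_swap_apply _ _ _)
    · exact Or.inl rfl
  have hnext : ∀ t, ((t + 1) / n = t / n ∧ (t + 1) % n = t % n + 1 ∧ t % n + 1 < n) ∨
      ((t + 1) / n = t / n + 1 ∧ (t + 1) % n = 0 ∧ t % n + 1 = n) := by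
    intro t
    have h1 := Nat.mod_lt t hn
    have h2 := Nat.div_add_mod' t n
    rcases Nat.lt_or_ge (t % n + 1) n with h | h
    · left
      have h3 : t + 1 = t / n * n + (t % n + 1) := by omega
      exact ⟨by rw [h3, mul_add_div_of_lt _ h], by rw [h3, mul_add_mod_of_lt _ h], h⟩
    · right
      have h3 : t + 1 = (t / n + 1) * n + 0 := by rw [Nat.succ_mul]; omega
      exact ⟨by rw [h3, mul_add_div_of_lt _ hn], by rw [h3, mul_add_mod_of_lt _ hn], by omega⟩
  -- Invariant: P stays weakly to the right of column s % n. The bound is the position of the bottom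
  -- edge of that column once row u / n has passed it, and of its top edge, one less, before that.
  have key : ∀ u, s + 1 ≤ u →
      (run (tilePos n) D u)⁻¹ P ≤ u / n + (n - 1 - s % n) + 1 ∧
      (n - 1 - s % n ≤ n - 1 - u % n → (run (tilePos n) D u)⁻¹ P ≤ u / n + (n - 1 - s % n)) := by
    intro u hu
    have hsn := Nat.mod_lt s hn
    induction u, hu using Nat.le_induction with
    | base =>
      have h1 := hmem s hs
      have h2 := hstep s
      have h3 := hnext s
      rw [Equiv.swap_apply_def] at h2
      have h4 : tilePos n s = s / n + (n - 1 - s % n) := rfl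
      refine ⟨?_, fun _ => ?_⟩ <;> split_ifs at h2 <;> omega
    | succ u hu ih =>
      have h2 := hstep u
      have h3 := hnext u
      have hun := Nat.mod_lt u hn
      rw [Equiv.swap_apply_def] at h2
      have h4 : tilePos n u = u / n + (n - 1 - u % n) := rfl
      refine ⟨?_, fun _ => ?_⟩ <;> split_ifs at h2 <;> omega
  have h1 := key t hst
  have h2 := hmem t ht
  have h3 := Nat.mod_lt s hn
  have h4 := Nat.mod_lt t hn
  have h5 : tilePos n t = t / n + (n - 1 - t % n) := rfl
  omega

theorem crossedBefore_iff_exists {D : Finset (Fin n × Fin n)} {p : Fin n × Fin n} (hp : p ∉ D) :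
    CrossedBefore D p ↔ ∃ s < tileIndex p, s ∈ tileSet D ∧
      labelsAt (tilePos n) (tileSet D) s = labelsAt (tilePos n) (tileSet D) (tileIndex p) := by
  constructor
  · rintro ⟨q, hq, h1, h2, h3⟩
    refine ⟨tileIndex q, ?_, tileIndex_mem.2 hq, (pipesAt_eq_iff D q p).1 h3⟩
    refine lt_of_le_of_ne ?_ fun h => hp (tileIndex_injective h ▸ hq)
    exact add_le_add (Nat.mul_le_mul_right n h1) (Fin.rev_le_rev.2 h2)
  · rintro ⟨s, hs, hsD, hl⟩
    obtain ⟨q, hq, rfl⟩ := Finset.mem_image.1 hsD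
    refine ⟨q, hq, ?_, ?_, (pipesAt_eq_iff D q p).2 hl⟩
    · have := Nat.div_le_div_right (c := n) hs.le
      rwa [tileIndex_div, tileIndex_div] at this
    -- Reading order only controls the rows; the column comparison needs a pipe common to both
    -- tiles.
    · have := mod_le_mod_of_label hs (Fin.pos p.1) (tileSet D) _ (Sym2.mem_mk_left _ _)
        (hl ▸ Sym2.mem_mk_left _ _)
      rw [tileIndex_mod, tileIndex_mod] at this
      exact Fin.rev_le_rev.1 this

theorem IsReduced.crossedBefore_iff {D : Finset (Fin n × Fin n)} (hD : IsReduced D)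
    {p : Fin n × Fin n} (hp : p ∉ D) :
    CrossedBefore D p ↔ frontier D (tileIndex p) (tilePos n (tileIndex p) + 1)
      < frontier D (tileIndex p) (tilePos n (tileIndex p)) := by
  rw [crossedBefore_iff_exists hp, frontier]
  exact exists_crossed_iff fun s hs => (isReduced_iff D).1 hD s (hs.trans (tileIndex_lt p))

/-- The two pipes of an elbow on or below the main diagonal never cross before. -/
theorem not_crossedBefore_of_lt {D : Finset (Fin n × Fin n)} (hP : IsPipeDream D)
    (hD : IsReduced D) {p : Fin n × Fin n} (hp : n < (p.1 : ℕ) + p.2 + 2) :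
    ¬ CrossedBefore D p := by
  have hpD : p ∉ D := fun h => by
    have := hP p h
    omega
  rw [hD.crossedBefore_iff hpD, tilePos_tileIndex,
    hP.frontier_apply_of_le _ (m := (p.1 : ℕ) + p.2 + 1) (by omega)]
  -- The label at position p.1 + p.2 + 1 ≥ n is that number itself; a larger label just before it
  -- would also be a fixed point, against injectivity.
  intro h
  have h2 := hP.frontier_apply_of_le (tileIndex p)
    (m := frontier D (tileIndex p) (p.1 + p.2)) (by omega)
  have h3 := (frontier D (tileIndex p)).injective h2
  omega

end Tiles

/-! ### Pipe dream sums as coefficients -/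

/-- The permutation of `ℕ` that extends `w` by the identity. -/
def extendPerm {n : ℕ} (w : Equiv.Perm (Fin n)) : Equiv.Perm ℕ :=
  w.extendDomain Fin.equivSubtype

/-- Extension of a family indexed by `Fin n` by zero. -/
def extendZero {n : ℕ} {K : Type*} [Zero K] (x : Fin n → K) (i : ℕ) : K :=
  if h : i < n then x ⟨i, h⟩ else 0

/-- The generating function of the reduced pipe dreams with permutation `w`. -/
noncomputable def pipeSum {n : ℕ} {K : Type*} [Field K] (x y : Fin n → K)
    (w : Equiv.Perm (Fin n)) : K :=
  ∑ D ∈ reducedPipeDreams w, pipeWeight x y D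

section PipeSum

variable {n : ℕ}

theorem extendPerm_apply (w : Equiv.Perm (Fin n)) (i : Fin n) : extendPerm w i = w i :=
  Equiv.Perm.extendDomain_apply_image w Fin.equivSubtype i

theorem extendPerm_apply_of_le (w : Equiv.Perm (Fin n)) {m : ℕ} (hm : n ≤ m) :
    extendPerm w m = m :=
  Equiv.Perm.extendDomain_apply_not_subtype w Fin.equivSubtype hm.not_gt

theorem extendPerm_mul_simpleRefl (w : Equiv.Perm (Fin n)) (i : ℕ) (hi : i + 1 < n) :
    extendPerm (w * simpleRefl n i hi) = extendPerm w * Equiv.swap i (i + 1) := by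
  ext m
  rcases Nat.lt_or_ge m n with hm | hm
  · have h1 : Equiv.swap i (i + 1) m = (simpleRefl n i hi ⟨m, hm⟩ : ℕ) := by
      simp only [simpleRefl, Equiv.swap_apply_def, Fin.ext_iff]
      split_ifs <;> rfl
    rw [extendPerm_apply _ ⟨m, hm⟩, Equiv.Perm.mul_apply, Equiv.Perm.mul_apply, h1,
      extendPerm_apply]
  · rw [extendPerm_apply_of_le _ hm, Equiv.Perm.mul_apply,
      Equiv.swap_apply_of_ne_of_ne (by omega) (by omega), extendPerm_apply_of_le _ hm]

theorem extendZero_apply {K : Type*} [Zero K] (x : Fin n → K) (i : Fin n) :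
    extendZero x i = x i := dif_pos i.isLt

theorem IsPipeDream.hasPerm_iff_frontier {D : Finset (Fin n × Fin n)} (hD : IsPipeDream D)
    (w : Equiv.Perm (Fin n)) : HasPerm D w ↔ frontier D (n * n) = extendPerm w := by
  rw [hasPerm_iff]
  constructor
  · intro h
    ext m
    rcases Nat.lt_or_ge m n with hm | hm
    · exact (h ⟨m, hm⟩).trans (extendPerm_apply w ⟨m, hm⟩).symm
    · rw [hD.frontier_apply_of_le _ hm, extendPerm_apply_of_le _ hm]
  · intro h i
    rw [h, extendPerm_apply]

theorem tileWeight_tileIndex {K : Type*} [Field K] (x y : Fin n → K) (p : Fin n × Fin n) :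
    tileWeight n (extendZero x) (extendZero y) (tileIndex p)
      = if (p.1 : ℕ) + p.2 + 2 ≤ n then x p.1 / y p.2 else 1 := by
  rw [tileWeight, tilePos_tileIndex, tileIndex_div, sub_tileIndex_mod, extendZero_apply,
    extendZero_apply]

theorem runWeight_tileSet {K : Type*} [Field K] (x y : Fin n → K) (D : Finset (Fin n × Fin n)) :
    runWeight (tilePos n) (tileWeight n (extendZero x) (extendZero y)) (tileSet D) (n * n)
      = ∏ p : Fin n × Fin n,
        if p ∈ D then 1 - (if (p.1 : ℕ) + p.2 + 2 ≤ n then x p.1 / y p.2 else 1)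
        else if frontier D (tileIndex p) (tilePos n (tileIndex p) + 1)
            < frontier D (tileIndex p) (tilePos n (tileIndex p)) then
          (if (p.1 : ℕ) + p.2 + 2 ≤ n then x p.1 / y p.2 else 1) else 1 := by
  rw [runWeight, ← image_tileIndex_univ, Finset.prod_image tileIndex_injective.injOn]
  refine Finset.prod_congr rfl fun p _ => ?_
  rw [tileWeight_tileIndex]
  exact if_congr tileIndex_mem rfl rfl

theorem pipeWeight_eq_runWeight {K : Type*} [Field K] (x y : Fin n → K)
    {D : Finset (Fin n × Fin n)} (hP : IsPipeDream D) (hD : IsReduced D) :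
    pipeWeight x y D =
      runWeight (tilePos n) (tileWeight n (extendZero x) (extendZero y)) (tileSet D) (n * n) := by
  rw [runWeight_tileSet, pipeWeight]
  refine Finset.prod_congr rfl fun p _ => ?_
  by_cases hp : p ∈ D
  · have := hP p hp
    rw [if_pos hp, if_pos hp, if_pos (by omega)]
  · rw [if_neg hp, if_neg hp]
    simp only [← hD.crossedBefore_iff hp]
    by_cases hn : (p.1 : ℕ) + p.2 + 2 ≤ n
    · rw [if_pos hn]
    · rw [if_neg (not_crossedBefore_of_lt hP hD (by omega)),
        if_neg (not_crossedBefore_of_lt hP hD (by omega))]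

/-- Outside the staircase the parameter is 1, so a crossing there contributes 1 - 1 = 0. This allows
the sum to run over all subsets of the grid. -/
theorem runWeight_eq_zero {K : Type*} [Field K] (x y : Fin n → K)
    {D : Finset (Fin n × Fin n)} (hP : ¬ IsPipeDream D) :
    runWeight (tilePos n) (tileWeight n (extendZero x) (extendZero y)) (tileSet D) (n * n) = 0 := by
  unfold IsPipeDream at hP
  push Not at hP
  obtain ⟨p, hp, hlt⟩ := hP
  rw [runWeight_tileSet]
  refine Finset.prod_eq_zero (Finset.mem_univ p) ?_
  rw [if_pos hp, if_neg (by omega), sub_self]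

theorem pipeSum_eq_heckeFold {K : Type*} [Field K] (x y : Fin n → K) (w : Equiv.Perm (Fin n)) :
    pipeSum x y w = heckeFold (tilePos n) (tileWeight n (extendZero x) (extendZero y)) (n * n)
      (extendPerm w) := by
  classical
  rw [heckeFold_eq_sum, ← image_tileIndex_univ, Finset.powerset_image,
    Finset.sum_image (Finset.image_injective tileIndex_injective).injOn, Finset.powerset_univ,
    pipeSum, reducedPipeDreams, Finset.sum_filter]
  refine Finset.sum_congr rfl fun D _ => ?_
  change _ = if AscendsBefore (tilePos n) (tileSet D) (n * n) ∧ frontier D (n * n) = extendPerm w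
    then runWeight (tilePos n) (tileWeight n (extendZero x) (extendZero y)) (tileSet D) (n * n)
    else 0
  by_cases hP : IsPipeDream D
  · rw [← isReduced_iff, ← hP.hasPerm_iff_frontier]
    by_cases h : IsReduced D ∧ HasPerm D w
    · rw [if_pos h, if_pos ⟨hP, h⟩, pipeWeight_eq_runWeight x y hP h.1]
    · rw [if_neg h, if_neg fun h' => h h'.2]
  · rw [if_neg fun h => hP h.1, runWeight_eq_zero x y hP, ite_self]

/-! ### The longest element -/

/-- The pipe dream in which all tiles above the main diagonal are crossings. -/
def staircase (n : ℕ) : Finset (Fin n × Fin n) :=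
  Finset.univ.filter fun p : Fin n × Fin n => (p.1 : ℕ) + 1 + ((p.2 : ℕ) + 1) ≤ n

theorem isPipeDream_staircase : IsPipeDream (staircase n) := fun _ hp =>
  (Finset.mem_filter.1 hp).2

theorem crossAt_staircase {r c : ℕ} (hr : r < n) (hc : c < n) :
    CrossAt (staircase n) r c ↔ r < c := by
  simp only [CrossAt, staircase, Finset.mem_filter, Finset.mem_univ, true_and]
  constructor
  · rintro ⟨p, hp, rfl, rfl⟩
    rw [Fin.val_rev]
    omega
  · intro h
    refine ⟨(⟨r, hr⟩, Fin.rev ⟨c, hc⟩), ?_, rfl, by rw [Fin.rev_rev]⟩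
    rw [Fin.val_rev]
    simp only
    omega

/-- Row r carries the largest remaining label, n-1-r, from position n-1 to position r. The `min`
reflects that the elbows in columns c ≤ r leave it at n-1. -/
theorem frontier_staircase {r c : ℕ} (hr : r < n) (hc : c ≤ n) (m : ℕ) :
    frontier (staircase n) (r * n + c) m =
      if m < r then n - 1 - m
      else if m < min (r + (n - c)) (n - 1) then m - r
      else if m = min (r + (n - c)) (n - 1) then n - 1 - r
      else if m < n then m - r - 1 else m := by
  have hstep : ∀ r < n, ∀ c < n, (∀ m, frontier (staircase n) (r * n + c) m =
      if m < r then n - 1 - m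
      else if m < min (r + (n - c)) (n - 1) then m - r
      else if m = min (r + (n - c)) (n - 1) then n - 1 - r
      else if m < n then m - r - 1 else m) → ∀ m, frontier (staircase n) (r * n + (c + 1)) m =
      if m < r then n - 1 - m
      else if m < min (r + (n - (c + 1))) (n - 1) then m - r
      else if m = min (r + (n - (c + 1))) (n - 1) then n - 1 - r
      else if m < n then m - r - 1 else m := by
    intro r hr c hc ih m
    rw [frontier_row_succ _ _ hc]
    simp only [crossAt_staircase hr hc]
    by_cases hrc : r < c
    · rw [if_pos hrc, Equiv.Perm.mul_apply, ih, min_eq_left (by omega), min_eq_left (by omega),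
        Equiv.swap_apply_def]
      by_cases h1 : m = r + (n - 1 - c)
      · subst h1
        rw [if_pos rfl]
        split_ifs <;> omega
      · rw [if_neg h1]
        by_cases h2 : m = r + (n - 1 - c) + 1
        · subst h2
          rw [if_pos rfl]
          split_ifs <;> omega
        · rw [if_neg h2]
          split_ifs <;> omega
    · rw [if_neg hrc, ih, min_eq_right (by omega), min_eq_right (by omega)]
  have hrow : ∀ r < n, (∀ m, frontier (staircase n) (r * n + 0) m =
      if m < r then n - 1 - m
      else if m < min (r + (n - 0)) (n - 1) then m - r
      else if m = min (r + (n - 0)) (n - 1) then n - 1 - r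
      else if m < n then m - r - 1 else m) → ∀ c ≤ n, ∀ m,
      frontier (staircase n) (r * n + c) m =
      if m < r then n - 1 - m
      else if m < min (r + (n - c)) (n - 1) then m - r
      else if m = min (r + (n - c)) (n - 1) then n - 1 - r
      else if m < n then m - r - 1 else m := by
    intro r hr h0 c
    induction c with
    | zero => exact fun _ => h0
    | succ c ih => exact fun hc => hstep r hr c hc (ih (by omega))
  refine hrow r hr ?_ c hc m
  clear hc m
  induction r with
  | zero =>
    intro m
    rw [min_eq_right (by omega)]
    have h : frontier (staircase n) (0 * n + 0) = 1 := by simp [frontier, run]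
    rw [h, Equiv.Perm.one_apply]
    split_ifs <;> omega
  | succ r ih =>
    intro m
    rw [Nat.succ_mul, add_zero, hrow r (by omega) (ih (by omega)) n le_rfl m,
      min_eq_left (by omega), min_eq_right (by omega)]
    split_ifs <;> omega

theorem isReduced_staircase : IsReduced (staircase n) := by
  rw [isReduced_iff]
  intro s _ hs
  obtain ⟨p, hp, rfl⟩ := Finset.mem_image.1 hs
  have hp := isPipeDream_staircase p hp
  change frontier (staircase n) (tileIndex p) _ < frontier (staircase n) (tileIndex p) _
  rw [tilePos_tileIndex, tileIndex, frontier_staircase p.1.isLt (Fin.rev p.2).isLt.le,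
    frontier_staircase p.1.isLt (Fin.rev p.2).isLt.le, Fin.val_rev, min_eq_left (by omega)]
  split_ifs <;> omega

theorem hasPerm_staircase : HasPerm (staircase n) Fin.revPerm := by
  rw [hasPerm_iff]
  intro i
  rw [frontier_row_apply_of_lt _ (Nat.succ_le_of_lt i.isLt) (Nat.lt_succ_self (i : ℕ)),
    Nat.succ_mul, frontier_staircase i.isLt le_rfl, Fin.revPerm_apply, Fin.val_rev]
  split_ifs <;> omega

/-- By counting: all pairs a < b < n are inverted by w₀, hence crossed in D, so D has at least as
many tiles as the staircase that contains it. -/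
theorem eq_staircase {D : Finset (Fin n × Fin n)} (hP : IsPipeDream D) (hD : IsReduced D)
    (hw : HasPerm D Fin.revPerm) : D = staircase n := by
  have hsub : D ⊆ staircase n := fun p hp => Finset.mem_filter.2 ⟨Finset.mem_univ p, hP p hp⟩
  refine Finset.eq_of_subset_of_card_le hsub ?_
  -- Encodes staircase tiles injectively as pairs a < b < n.
  set g : Fin n × Fin n → ℕ × ℕ := fun p => (p.1, p.1 + p.2 + 1) with hg
  have hginj : Function.Injective g := by
    intro p q h
    simp only [hg, Prod.mk.injEq] at h
    exact Prod.ext (Fin.ext h.1) (Fin.ext (by omega))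
  rw [← Finset.card_image_of_injective _ hginj]
  refine (Finset.card_le_card ?_).trans (Finset.card_image_le (s := D)
    (f := fun p => (frontier D (tileIndex p) (tilePos n (tileIndex p)),
      frontier D (tileIndex p) (tilePos n (tileIndex p) + 1))))
  intro ab hab
  obtain ⟨p, hp, rfl⟩ := Finset.mem_image.1 hab
  have hp := isPipeDream_staircase p hp
  have hinv : ∀ a < n, (frontier D (n * n))⁻¹ a = n - 1 - a := by
    intro a ha
    rw [Equiv.Perm.inv_eq_iff_eq]
    have := (hasPerm_iff D _).1 hw ⟨n - 1 - a, by omega⟩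
    rw [this, Fin.revPerm_apply, Fin.val_rev]
    simp only
    omega
  obtain ⟨s, -, hsD, h1, h2⟩ := (inverted_iff_crossed ((isReduced_iff D).1 hD)
    (a := (p.1 : ℕ)) (b := p.1 + p.2 + 1) (by omega)).1 (by
      change (frontier D (n * n))⁻¹ _ < (frontier D (n * n))⁻¹ _
      rw [hinv _ (by omega), hinv _ (by omega)]
      omega)
  obtain ⟨q, hq, rfl⟩ := Finset.mem_image.1 hsD
  exact Finset.mem_image.2 ⟨q, hq, Prod.ext h1 h2⟩

theorem pipeSum_revPerm {K : Type*} [Field K] (x y : Fin n → K) :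
    pipeSum x y Fin.revPerm = ∏ p ∈ staircase n, (1 - x p.1 / y p.2) := by
  have h : reducedPipeDreams (Fin.revPerm (n := n)) = {staircase n} := by
    ext D
    simp only [reducedPipeDreams, Finset.mem_filter, Finset.mem_univ, true_and,
      Finset.mem_singleton]
    constructor
    · exact fun h => eq_staircase h.1 h.2.1 h.2.2
    · rintro rfl
      exact ⟨isPipeDream_staircase, isReduced_staircase, hasPerm_staircase⟩
  rw [pipeSum, h, Finset.sum_singleton, pipeWeight, ← Finset.prod_filter_mul_prod_filter_not
    Finset.univ (· ∈ staircase n), Finset.filter_mem_eq_inter, Finset.univ_inter]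
  rw [Finset.prod_congr rfl fun p hp => if_pos hp, Finset.prod_eq_one (s := Finset.filter _ _),
    mul_one]
  intro p hp
  have hp := (Finset.mem_filter.1 hp).2
  have hlt : n < (p.1 : ℕ) + p.2 + 2 := by
    by_contra h
    exact hp (Finset.mem_filter.2 ⟨Finset.mem_univ p, by omega⟩)
  rw [if_neg hp, if_neg (not_crossedBefore_of_lt isPipeDream_staircase isReduced_staircase hlt)]

end PipeSum

/-! ### The divided difference recursion -/

section Recursion

variable {n : ℕ}

theorem map_heckeFold {K L : Type*} [CommRing K] [CommRing L] (σ : K →+* L) (pos : ℕ → ℕ)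
    (a : ℕ → K) (t : ℕ) (v : Equiv.Perm ℕ) :
    σ (heckeFold pos a t v) = heckeFold pos (fun s => σ (a s)) t v := by
  induction t generalizing v with
  | zero => simp only [heckeFold, apply_ite σ, map_one, map_zero]
  | succ t ih =>
    rw [heckeFold, heckeFold, map_heckeOp]
    exact congrFun (congrArg _ (funext ih)) v

theorem map_pipeSum {K : Type*} [Field K] (x y : Fin n → K) (σ : K →+* K) {i : ℕ}
    (hi : i + 1 < n) (hσx : ∀ j, σ (x j) = x (simpleRefl n i hi j)) (hσy : ∀ j, σ (y j) = y j)
    (hx : x ⟨i, Nat.lt_of_succ_lt hi⟩ ≠ 0) {w : Equiv.Perm (Fin n)}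
    (hw : w ⟨i + 1, hi⟩ < w ⟨i, Nat.lt_of_succ_lt hi⟩) :
    σ (pipeSum x y w) = x ⟨i + 1, hi⟩ / x ⟨i, Nat.lt_of_succ_lt hi⟩ * pipeSum x y w
      + (1 - x ⟨i + 1, hi⟩ / x ⟨i, Nat.lt_of_succ_lt hi⟩)
        * pipeSum x y (w * simpleRefl n i hi) := by
  have hX : ∀ m, σ (extendZero x m) = (extendZero x ∘ Equiv.swap i (i + 1)) m := by
    intro m
    rw [Function.comp_apply]
    rcases Nat.lt_or_ge m n with hm | hm
    · have h1 : Equiv.swap i (i + 1) m = (simpleRefl n i hi ⟨m, hm⟩ : ℕ) := by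
        simp only [simpleRefl, Equiv.swap_apply_def, Fin.ext_iff]
        split_ifs <;> rfl
      rw [h1, extendZero_apply, ← hσx, extendZero, dif_pos hm]
    · rw [Equiv.swap_apply_of_ne_of_ne (by omega) (by omega), extendZero, dif_neg hm.not_gt,
        map_zero]
  have hY : ∀ m, σ (extendZero y m) = extendZero y m := by
    intro m
    unfold extendZero
    split_ifs
    exacts [hσy _, map_zero σ]
  have hW : (fun t => σ (tileWeight n (extendZero x) (extendZero y) t))
      = tileWeight n (extendZero x ∘ Equiv.swap i (i + 1)) (extendZero y) := by
    funext t
    simp only [tileWeight, apply_ite σ, map_div₀, hX, hY, map_one]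
  have hxi : extendZero x i = x ⟨i, Nat.lt_of_succ_lt hi⟩ := dif_pos _
  have hxi' : extendZero x (i + 1) = x ⟨i + 1, hi⟩ := dif_pos _
  have hlt : extendPerm w (i + 1) < extendPerm w i := by
    have h1 := extendPerm_apply w ⟨i, Nat.lt_of_succ_lt hi⟩
    have h2 := extendPerm_apply w ⟨i + 1, hi⟩
    simp only at h1 h2
    rwa [h1, h2]
  simp only [pipeSum_eq_heckeFold]
  rw [map_heckeFold, hW, heckeFold_comp_swap _ _ hi (by rwa [hxi]), heckeOp, if_pos hlt,
    extendPerm_mul_simpleRefl, hxi, hxi']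

/-- Applying the transposition to both positions injects the inversions of w into those of w s_i and
misses (i, i+1). -/
theorem permLength_lt_mul_simpleRefl {w : Equiv.Perm (Fin n)} {i : ℕ} (hi : i + 1 < n)
    (hw : w ⟨i, Nat.lt_of_succ_lt hi⟩ < w ⟨i + 1, hi⟩) :
    permLength w < permLength (w * simpleRefl n i hi) := by
  set a : Fin n := ⟨i, Nat.lt_of_succ_lt hi⟩ with ha
  set b : Fin n := ⟨i + 1, hi⟩ with hb
  have hs : simpleRefl n i hi = Equiv.swap a b := rfl
  rw [hs]
  unfold permLength
  set f : Fin n × Fin n → Fin n × Fin n := fun p => (Equiv.swap a b p.1, Equiv.swap a b p.2)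
    with hf
  have hfinj : Function.Injective f := fun p q h =>
    Prod.ext ((Equiv.swap a b).injective (congrArg Prod.fst h))
      ((Equiv.swap a b).injective (congrArg Prod.snd h))
  rw [← Finset.card_image_of_injective _ hfinj]
  refine Finset.card_lt_card ((Finset.ssubset_iff_of_subset ?_).2 ⟨(a, b), ?_, ?_⟩)
  · intro q hq
    obtain ⟨⟨p, p'⟩, hp, rfl⟩ := Finset.mem_image.1 hq
    obtain ⟨h1, h2⟩ := (Finset.mem_filter.1 hp).2
    simp only at h1 h2
    refine Finset.mem_filter.2 ⟨Finset.mem_univ _, ?_, by simpa [hf] using h2⟩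
    have hne : ¬ (p = a ∧ p' = b) := by
      rintro ⟨rfl, rfl⟩
      exact h2.not_gt hw
    simp only [hf, Equiv.swap_apply_def]
    simp only [Fin.ext_iff, Fin.lt_def, ha, hb] at hne h1 ⊢
    split_ifs <;> first | omega | (simp only; omega)
  · refine Finset.mem_filter.2 ⟨Finset.mem_univ _, ?_, by simpa using hw⟩
    simp [Fin.lt_def, ha, hb]
  · intro h
    obtain ⟨⟨p, p'⟩, hp, hpq⟩ := Finset.mem_image.1 h
    have hlt := (Finset.mem_filter.1 hp).2.1
    have h1 : p = b :=
      (Equiv.swap_apply_eq_iff.1 (congrArg Prod.fst hpq)).trans (Equiv.swap_apply_left a b)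
    have h2 : p' = a :=
      (Equiv.swap_apply_eq_iff.1 (congrArg Prod.snd hpq)).trans (Equiv.swap_apply_right a b)
    simp only [h1, h2, Fin.lt_def, ha, hb] at hlt
    omega

theorem descent_of_permLength_lt {w : Equiv.Perm (Fin n)} {i : ℕ} (hi : i + 1 < n)
    (h : permLength (w * simpleRefl n i hi) < permLength w) :
    w ⟨i + 1, hi⟩ < w ⟨i, Nat.lt_of_succ_lt hi⟩ := by
  refine lt_of_le_of_ne (not_lt.1 fun hlt => ?_) (w.injective.ne (by simp [Fin.ext_iff]))
  exact (permLength_lt_mul_simpleRefl hi hlt).not_gt h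

/-- Without ascents w is strictly decreasing; precomposed with the reversal it is an increasing
surjection, hence the identity. -/
theorem eq_revPerm_of_forall_not_lt {w : Equiv.Perm (Fin n)}
    (h : ∀ (i : ℕ) (hi : i + 1 < n), ¬ permLength w < permLength (w * simpleRefl n i hi)) :
    w = Fin.revPerm := by
  have hanti : StrictAnti w := by
    cases n with
    | zero => exact fun a => a.elim0
    | succ n =>
      rw [Fin.strictAnti_iff_succ_lt]
      intro i
      refine lt_of_le_of_ne (not_lt.1 fun hlt => h i (by omega) ?_)
        (w.injective.ne (Fin.castSucc_lt_succ (i := i)).ne')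
      exact permLength_lt_mul_simpleRefl _ hlt
  have hmono : StrictMono fun i => w (Fin.rev i) := fun i j hij => hanti (Fin.rev_lt_rev.2 hij)
  have hid : (fun i => w (Fin.rev i)) = id :=
    (hmono.range_inj strictMono_id).1
      (by rw [Set.range_id, Set.range_eq_univ]; exact w.surjective.comp Fin.rev_surjective)
  ext i
  have := congrFun hid (Fin.rev i)
  simp only [Fin.rev_rev, id] at this
  rw [this, Fin.revPerm_apply]

variable (R : Type*) [CommRing R]

theorem permX_xVar (u : Equiv.Perm (Fin n)) (i : Fin n) :
    permX n R u (xVar n R i) = xVar n R (u i) := by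
  simp [permX, xVar]

theorem permX_yVar (u : Equiv.Perm (Fin n)) (j : Fin n) :
    permX n R u (yVar n R j) = yVar n R j := by
  simp [permX, yVar]

variable [IsDomain R]

theorem xVar_injective : Function.Injective (xVar n R) := fun _ _ h =>
  Sum.inl_injective (MvPolynomial.X_injective (IsFractionRing.injective _ (RatFun n R) h))

theorem xVar_ne_zero (i : Fin n) : xVar n R i ≠ 0 := by
  rw [xVar, Ne, map_eq_zero_iff _ (IsFractionRing.injective _ (RatFun n R))]
  exact MvPolynomial.X_ne_zero _

theorem isGrothendieckFamily_pipeSum :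
    IsGrothendieckFamily n R (pipeSum (xVar n R) (yVar n R)) := by
  refine ⟨pipeSum_revPerm _ _, fun w i hi h => ?_⟩
  have hx := xVar_ne_zero R (⟨i, Nat.lt_of_succ_lt hi⟩ : Fin n)
  have hne : xVar n R ⟨i + 1, hi⟩ - xVar n R ⟨i, Nat.lt_of_succ_lt hi⟩ ≠ 0 :=
    sub_ne_zero.2 ((xVar_injective R).ne (by simp [Fin.ext_iff]))
  have key := map_pipeSum (xVar n R) (yVar n R) (permX n R (simpleRefl n i hi)).toRingHom hi
    (permX_xVar R _) (permX_yVar R _) hx (descent_of_permLength_lt hi h)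
  change permX n R (simpleRefl n i hi) _ = _ at key
  rw [divDiff, key, eq_div_iff hne]
  field_simp
  ring

/-- Every chosen chain of ascents ends at w₀, so descending induction on length makes the choices
irrelevant once some family satisfies the recursion. -/
theorem IsGrothendieckFamily.doubleGrothendieck_eq {G : Equiv.Perm (Fin n) → RatFun n R}
    (hG : IsGrothendieckFamily n R G) (w : Equiv.Perm (Fin n)) :
    doubleGrothendieck n R w = G w := by
  induction hN : n * n - permLength w using Nat.strong_induction_on generalizing w with
  | _ N ih =>
    rw [doubleGrothendieck]
    split_ifs with h
    · have hlt := h.choose_spec.choose_spec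
      have hle := permLength_le (w * simpleRefl n h.choose h.choose_spec.choose)
      have hinv : w * simpleRefl n h.choose h.choose_spec.choose
          * simpleRefl n h.choose h.choose_spec.choose = w := by
        simp [simpleRefl]
      have hrec := hG.2 (w * simpleRefl n h.choose h.choose_spec.choose) h.choose
        h.choose_spec.choose (by rwa [hinv])
      rw [hinv] at hrec
      rw [hrec, ih _ (by omega) _ rfl]
    · push Not at h
      rw [eq_revPerm_of_forall_not_lt fun i hi => (h i hi).not_gt, hG.1]

end Recursion

end Grothendieck

theorem corollary8p8 (n : ℕ) (R : Type*) [CommRing R] [IsDomain R] :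
    Grothendieck.IsGrothendieckFamily n R (Grothendieck.doubleGrothendieck n R) ∧
      ∀ w : Equiv.Perm (Fin n),
        Grothendieck.doubleGrothendieck n R w =
          ∑ D ∈ Grothendieck.reducedPipeDreams w,
            Grothendieck.pipeWeight (Grothendieck.xVar n R) (Grothendieck.yVar n R) D := by
  have hG := Grothendieck.isGrothendieckFamily_pipeSum (n := n) R
  have heq := hG.doubleGrothendieck_eq R
  exact ⟨(funext heq : Grothendieck.doubleGrothendieck n R = _) ▸ hG, heq⟩
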